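/- Let $n\ge 0$ and $k,d\ge 1$ be integers. The parameter space of homoscedastic $k$-mixtures of $n$-dimensional Gaussians is the real affine space $$\Theta^H_{n,k}=\Big\{(\mu_1,\dots,\mu_k),(\lambda_1,\dots,\lambda_k),\Sigma \;\Big|\; \mu_i\in\mathbb R^n,\ \lambda_i\in\mathbb R,\ \sum_{i=1}^k\lambda_i=1,\ \Sigma\in\operatorname{Sym}^2\mathbb R^n\Big\}.$$ The moments of the mixture $\sum_i\lambda_i\,\mathcal N(\mu_i,\Sigma)$ are the polynomials $m_a$ $(a\in\mathbb N^n)$ in these parameters defined by $$\sum_{a\in\mathbb N^n} m_a\,\frac{u^a}{a!}=\sum_{i=1}^k\lambda_i\,\exp\!\big(u^t\mu_i+\tfrac12u^t\Sigma u\big).$$ Let $M_{n,k,d}:\theta\mapsto (m_a(\theta))_{|a|\le d}$ be the moment map on $\Theta^H_{n,k}$, and let $\operatorname{Sec}^H_k(\mathcal G_{n,d})$ be the Zariski closure of its image. A general homoscedastic $k$-mixture is called algebraically identifiable from its moments up to order $d$ if the general fiber dimension $$\Delta^H_{n,k,d}=\dim\Theta^H_{n,k}-\dim\operatorname{Sec}^H_k(\mathcal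 G_{n,d})$$ is $0$ and the fiber of $M_{n,k,d}$ over a general point of the image is finite, that is, there is a polynomial $g$ in the moments of order at most $d$, not vanishing identically on the image of $M_{n,k,d}$, such that $M_{n,k,d}^{-1}(p)$ is finite for every point $p$ of the image with $g(p)\neq0$. Theorem. Suppose $k\le n+1$. (i) If $k\ge5$, then a general homoscedastic $k$-mixture of $n$-dimensional Gaussians is algebraically identifiable from its moments up to order $3$. (ii) If $k\in\{2,3,4\}$, then a general homoscedastic $k$-mixture of $n$-dimensional Gaussians is algebraically identifiable from its moments up to order $4$. -/

import Mathlib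

open scoped Nat

noncomputable section

/-- The ambient space of triples `(μ, lam, S)` of `k` mean vectors in `ℝⁿ`, `k` mixture weights
and one `n × n` matrix. -/
abbrev MixtureData (n k : ℕ) : Type :=
  (Fin k → Fin n → ℝ) × (Fin k → ℝ) × Matrix (Fin n) (Fin n) ℝ

/-- The parameter space of homoscedastic `k`-mixtures of `n`-dimensional Gaussians: `k` means, `k`
weights of sum `1` and one common symmetric covariance matrix. It is an affine space. -/
def homoscedasticParams (n k : ℕ) : AffineSubspace ℝ (MixtureData n k) where
  carrier := {θ | ∑ i, θ.2.1 i = 1 ∧ θ.2.2.IsSymm}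
  smul_vsub_vadd_mem' := by
    rintro c ⟨μ₁, l₁, S₁⟩ ⟨μ₂, l₂, S₂⟩ ⟨μ₃, l₃, S₃⟩ ⟨h₁, s₁⟩ ⟨h₂, s₂⟩ ⟨h₃, s₃⟩
    refine ⟨?_, ?_⟩
    · simp only at h₁ h₂ h₃
      simp [Finset.sum_add_distrib, ← Finset.mul_sum, Finset.sum_sub_distrib, h₁, h₂, h₃]
    · exact ((s₁.sub s₂).smul c).add s₃

/-- The dimension of the parameter space. -/
def homoscedasticParamsDim (n k : ℕ) : ℕ :=
  Module.finrank ℝ (homoscedasticParams n k).direction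

/-- The cumulant generating polynomial `uᵗm + (1/2) uᵗSu` of a Gaussian with mean `m` and
covariance matrix `S`. -/
def gaussianCumulantPoly {n : ℕ} (m : Fin n → ℝ) (S : Matrix (Fin n) (Fin n) ℝ) :
    MvPolynomial (Fin n) ℝ :=
  ∑ i, MvPolynomial.C (m i) * MvPolynomial.X i +
    MvPolynomial.C (1 / 2 : ℝ) *
      ∑ i, ∑ j, MvPolynomial.C (S i j) * MvPolynomial.X i * MvPolynomial.X j

/-- The moment `m_a` of a Gaussian with mean `m` and covariance matrix `S`, as a polynomial in
`m` and `S`: it is `a! = a₁! ⋯ aₙ!` times the coefficient of `u^a` in the moment generating series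
`exp (uᵗm + (1/2) uᵗSu)`. As the exponent has no constant term, only its powers with exponent at
most `|a|` contribute to that coefficient. -/
def gaussianMoment {n : ℕ} (m : Fin n → ℝ) (S : Matrix (Fin n) (Fin n) ℝ) (a : Fin n →₀ ℕ) : ℝ :=
  (∏ i, ((a i)! : ℝ)) *
    MvPolynomial.coeff a
      (∑ j ∈ Finset.range (a.degree + 1),
        MvPolynomial.C (1 / (j ! : ℝ)) * gaussianCumulantPoly m S ^ j)

/-- The indices of the moments of order at most `d`. -/
abbrev MomentIndex (n d : ℕ) : Type := {a : Fin n →₀ ℕ // a.degree ≤ d}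

/-- The moment map: the moments of order at most `d` of the mixture
`∑ i, lam i • N(μ i, S)`. -/
def momentMap (n k d : ℕ) (θ : MixtureData n k) : MomentIndex n d → ℝ :=
  fun a => ∑ i, θ.2.1 i * gaussianMoment (θ.1 i) θ.2.2 a.1

/-- The image of the parameter space under the moment map; its Zariski closure is the
homoscedastic `k`-secant variety. -/
def homoscedasticSecant (n k d : ℕ) : Set (MomentIndex n d → ℝ) :=
  momentMap n k d '' (homoscedasticParams n k : Set (MixtureData n k))

/-- The dimension of (the Zariski closure of) a set `V` of points of affine space: the Krull
dimension of its coordinate ring. -/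
def zariskiDim {σ : Type*} (V : Set (σ → ℝ)) : WithBot ℕ∞ :=
  ringKrullDim (MvPolynomial σ ℝ ⧸ MvPolynomial.vanishingIdeal ℝ V)

/-- The general fiber dimension of the moment map, `dim Θ - dim Sec`, is zero. -/
def AlgebraicallyIdentifiable (n k d : ℕ) : Prop :=
  zariskiDim (homoscedasticSecant n k d) = (homoscedasticParamsDim n k : WithBot ℕ∞)

/-- The fiber of the moment map over a general point of its image is finite: this holds outside
the zero locus of a polynomial `g` in the moments that does not vanish identically on the image. -/
def GeneralFiberFinite (n k d : ℕ) : Prop :=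
  ∃ g : MvPolynomial (MomentIndex n d) ℝ,
    (∃ p ∈ homoscedasticSecant n k d, MvPolynomial.eval p g ≠ 0) ∧
      ∀ p ∈ homoscedasticSecant n k d, MvPolynomial.eval p g ≠ 0 →
        {θ | θ ∈ homoscedasticParams n k ∧ momentMap n k d θ = p}.Finite

end

/-!
Write `N` for the dimension of the parameter space. If the differential of the moment map is
injective at one point of the parameter space, then the Jacobian criterion gives `N` linear
combinations of the moments that are algebraically independent
(`exists_algebraicIndependent_of_deriv`). Every parameter is then algebraic over the ring generated
by the moments. Hence that ring, the coordinate ring of the secant variety, has Krull dimension `N`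
(`zariskiDim_range_eq`), and a parameter takes only finitely many values on a fiber over which its
equation stays nontrivial (`exists_finite_fibers`).

It remains to find such a point. For a direction `x`, the moments of order `D` of a Gaussian combine
to the coefficient of `s ^ D` in `exp (s p + s² q)`, where `p` is the value of the mean on `x` and
`q` half the value of the covariance form (`sum_gaussianMoment_mul_prod_pow`). So a tangent vector
in the kernel of the differential satisfies one identity between forms in `x` for each order
(`tangent_identities`). With `k = m + 1`, take covariance `0`, one mean at the origin and the others
at unit vectors `e₁, …, eₘ`, the latter with weight `2` each. The identity of order two expresses
the covariance part of the tangent vector by `aᵢ`, the variation of the weights, and `Bᵢⱼ`, twice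
that of the means. Substituting it in the identity of order three and comparing coefficients gives
`εᵢ + εⱼ + εₗ = 0` for distinct `i`, `j`, `l`, where `εᵢ = aᵢ / 2 + Bᵢᵢ`. If `m ≥ 4` all `εᵢ`
vanish, and with them the tangent vector (`CubicIdentity.eq_zero`). For smaller `m`, moments of order
four are needed: the coefficients of `xᵢ³` and `xᵢ⁴` already force `εᵢ = 0`
(`CubicIdentity.eq_zero_of_quartic`).
-/

open MvPolynomial

/-! ### Dimension and generic fibers of a polynomial map -/

/-- Krull dimension is invariant under injective integral extensions: incomparability bounds it
from above, lying over and going up lift chains of primes. -/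
theorem ringKrullDim_eq_of_isIntegral (R S : Type*) [CommRing R] [CommRing S] [Algebra R S]
    [Algebra.IsIntegral R S] [FaithfulSMul R S] : ringKrullDim S = ringKrullDim R := by
  apply le_antisymm
  · refine Order.krullDim_le_of_strictMono (PrimeSpectrum.comap (algebraMap R S)) ?_
    intro I J hIJ
    exact Ideal.IsIntegral.comap_lt_comap (R := R) (I := I.asIdeal) (J := J.asIdeal) hIJ
  · refine iSup_le fun l => ?_
    obtain ⟨Q⟩ := Ideal.nonempty_primesOver (S := S) l.head.asIdeal
    have := Q.2.1
    have := Q.2.2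
    obtain ⟨L, hL, -⟩ := Ideal.exists_ltSeries_of_hasGoingUp (S := S) l Q.1
    rw [← hL]
    exact Order.LTSeries.length_le_krullDim L

/-- The Krull dimension of a finitely generated domain over a field is its transcendence degree. -/
theorem ringKrullDim_eq_of_trdeg_eq (K A : Type*) [Field K] [CommRing A] [IsDomain A]
    [Algebra K A] [Algebra.FiniteType K A] {N : ℕ} (h : Algebra.trdeg K A = N) :
    ringKrullDim A = N := by
  obtain ⟨s, g, hinj, hint⟩ := exists_integral_inj_algHom_of_fg K A
  let _ : Algebra (MvPolynomial (Fin s) K) A := g.toRingHom.toAlgebra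
  have : Algebra.IsIntegral (MvPolynomial (Fin s) K) A := ⟨hint⟩
  have : FaithfulSMul (MvPolynomial (Fin s) K) A :=
    (faithfulSMul_iff_algebraMap_injective _ _).mpr hinj
  have : IsScalarTower K (MvPolynomial (Fin s) K) A :=
    IsScalarTower.of_algebraMap_eq fun r => (g.commutes r).symm
  have htr := lift_trdeg_add_eq K (MvPolynomial (Fin s) K) A
  rw [trdeg_eq_zero (R := MvPolynomial (Fin s) K) (A := A), MvPolynomial.trdeg_of_isDomain,
    h] at htr
  have hs : s = N := by simpa using htr
  rw [ringKrullDim_eq_of_isIntegral (MvPolynomial (Fin s) K) A,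
    MvPolynomial.ringKrullDim_of_isNoetherianRing, ringKrullDim_eq_zero_of_field]
  simp [hs]

theorem eval_aeval_eq {ι σ : Type*} (P : σ → MvPolynomial ι ℝ) (t : ι → ℝ) (F : MvPolynomial σ ℝ) :
    eval t (aeval P F) = eval (fun a => eval t (P a)) F := by
  induction F using MvPolynomial.induction_on with
  | C r => simp
  | add p q hp hq => rw [map_add, map_add, map_add, hp, hq]
  | mul_X p i hp => rw [map_mul, map_mul, map_mul, hp, aeval_X, eval_X]

/-- If the coordinate ring of the image of a polynomial map contains as many algebraically
independent elements as there are parameters, then the closure of the image has the dimension of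
the parameter space. -/
theorem zariskiDim_range_eq {ι σ : Type} [Fintype ι] [Finite σ] (P : σ → MvPolynomial ι ℝ)
    (G : ι → MvPolynomial ι ℝ) (hG : AlgebraicIndependent ℝ G)
    (hGP : ∀ j, G j ∈ (aeval P : MvPolynomial σ ℝ →ₐ[ℝ] MvPolynomial ι ℝ).range) :
    zariskiDim (Set.range fun (t : ι → ℝ) a => eval t (P a)) = (Fintype.card ι : WithBot ℕ∞) := by
  set ρ : MvPolynomial σ ℝ →ₐ[ℝ] MvPolynomial ι ℝ := aeval P with hρ
  have heval := eval_aeval_eq P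
  rw [← hρ] at heval
  have hker : vanishingIdeal ℝ (Set.range fun (t : ι → ℝ) a => eval t (P a)) =
      RingHom.ker ρ := by
    ext F
    rw [mem_vanishingIdeal_iff, RingHom.mem_ker]
    refine ⟨fun h => MvPolynomial.funext fun t => ?_, ?_⟩
    · rw [heval, map_zero]
      exact h _ ⟨t, rfl⟩
    · rintro h _ ⟨t, rfl⟩
      have := heval t F
      rw [h, map_zero] at this
      exact this.symm
  have hfg : Algebra.FiniteType ℝ ρ.range :=
    Algebra.FiniteType.of_surjective ρ.rangeRestrict ρ.rangeRestrict_surjective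
  have htr : Algebra.trdeg ℝ ρ.range = Fintype.card ι := by
    apply le_antisymm
    · refine (trdeg_le_of_injective ρ.range.val Subtype.val_injective).trans ?_
      rw [MvPolynomial.trdeg_of_isDomain]
      simp
    · have hG' : AlgebraicIndependent ℝ (fun j => (⟨G j, hGP j⟩ : ρ.range)) :=
        AlgebraicIndependent.of_comp ρ.range.val hG
      simpa using hG'.cardinalMk_le_trdeg
  rw [zariskiDim, hker]
  rw [ringKrullDim_eq_of_ringEquiv (Ideal.quotientKerEquivRange ρ).toRingEquiv]
  exact ringKrullDim_eq_of_trdeg_eq ℝ ρ.range htr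

/-- If the coordinate ring of the image of a polynomial map contains as many algebraically
independent elements as there are parameters, then every parameter is algebraic over it, hence
takes finitely many values on the fibers where the coefficients of its equation do not all
vanish. -/
theorem exists_finite_fibers {ι σ : Type} [Fintype ι] (P : σ → MvPolynomial ι ℝ)
    (G : ι → MvPolynomial ι ℝ) (hG : AlgebraicIndependent ℝ G)
    (hGP : ∀ j, G j ∈ (aeval P : MvPolynomial σ ℝ →ₐ[ℝ] MvPolynomial ι ℝ).range) :
    ∃ g : MvPolynomial σ ℝ, (∃ t : ι → ℝ, eval (fun a => eval t (P a)) g ≠ 0) ∧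
      ∀ p, eval p g ≠ 0 → {t : ι → ℝ | (fun a => eval t (P a)) = p}.Finite := by
  set ρ : MvPolynomial σ ℝ →ₐ[ℝ] MvPolynomial ι ℝ := aeval P with hρ
  have heval := eval_aeval_eq P
  rw [← hρ] at heval
  have hbasis : IsTranscendenceBasis ℝ G :=
    hG.isTranscendenceBasis_of_trdeg_le_of_finite (by rw [MvPolynomial.trdeg_of_isDomain]; simp)
  have halg := hbasis.isAlgebraic
  have hle : Algebra.adjoin ℝ (Set.range G) ≤ ρ.range :=
    Algebra.adjoin_le (by rintro _ ⟨j, rfl⟩; exact hGP j)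
  have key (i : ι) : ∃ F : Polynomial (MvPolynomial σ ℝ), (∃ e, ρ (F.coeff e) ≠ 0) ∧
      Polynomial.eval (X i) (F.map (ρ : MvPolynomial σ ℝ →+* MvPolynomial ι ℝ)) = 0 := by
    obtain ⟨f, hf0, hf⟩ := halg.isAlgebraic (X i : MvPolynomial ι ℝ)
    obtain ⟨F, hF⟩ : f.map (algebraMap (Algebra.adjoin ℝ (Set.range G)) (MvPolynomial ι ℝ)) ∈
        Polynomial.lifts (ρ : MvPolynomial σ ℝ →+* MvPolynomial ι ℝ) := by
      rw [Polynomial.lifts_iff_coeff_lifts]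
      intro e
      rw [Polynomial.coeff_map]
      exact hle (f.coeff e).2
    have hF' : F.map (ρ : MvPolynomial σ ℝ →+* MvPolynomial ι ℝ) =
        f.map (algebraMap (Algebra.adjoin ℝ (Set.range G)) (MvPolynomial ι ℝ)) := hF
    refine ⟨F, ⟨f.natDegree, ?_⟩, ?_⟩
    · have h1 := congrArg (fun q => Polynomial.coeff q f.natDegree) hF'
      simp only [Polynomial.coeff_map] at h1
      rw [RingHom.coe_coe] at h1
      rw [h1]
      simpa using hf0
    · rw [hF', Polynomial.eval_map_algebraMap]
      exact hf
  choose F e he hroot using fun i => (by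
    obtain ⟨F, ⟨e, he⟩, h⟩ := key i
    exact ⟨F, e, he, h⟩ : ∃ F : Polynomial (MvPolynomial σ ℝ), ∃ e, ρ (F.coeff e) ≠ 0 ∧
      Polynomial.eval (X i) (F.map (ρ : MvPolynomial σ ℝ →+* MvPolynomial ι ℝ)) = 0)
  refine ⟨∏ i, (F i).coeff (e i), ?_, fun p hp => ?_⟩
  · by_contra! h
    have h0 : ρ (∏ i, (F i).coeff (e i)) = 0 := MvPolynomial.funext fun t => by
      rw [heval, h t, map_zero]
    rw [map_prod, Finset.prod_eq_zero_iff] at h0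
    obtain ⟨i, -, hi⟩ := h0
    exact he i hi
  · rw [map_prod, Finset.prod_ne_zero_iff] at hp
    have hne (i : ι) : (F i).map (eval p) ≠ 0 := fun h => hp i (Finset.mem_univ i) (by
      rw [← Polynomial.coeff_map, h, Polynomial.coeff_zero])
    refine (Set.Finite.pi' fun i => ((F i).map (eval p)).rootSet_finite ℝ).subset ?_
    rintro t rfl i
    rw [Polynomial.mem_rootSet]
    refine ⟨hne i, ?_⟩
    have h1 := congrArg (eval t) (hroot i)
    rw [map_zero, ← Polynomial.eval₂_at_apply, ← Polynomial.eval_map, Polynomial.map_map,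
      eval_X] at h1
    rw [Polynomial.coe_aeval_eq_eval, ← h1]
    congr 2
    exact RingHom.ext fun Q => (heval t Q).symm

/-! ### A Jacobian criterion -/

/-- Jacobian criterion: if no nonzero direction at `0` kills all derivatives of a polynomial map,
then some linear combinations of its components, as many as there are variables, are
algebraically independent. -/
theorem exists_algebraicIndependent_of_deriv {ι σ : Type} [Fintype ι] [Fintype σ]
    (P : σ → MvPolynomial ι ℝ)
    (h : ∀ v : ι → ℝ, (∀ a, HasDerivAt (fun s : ℝ => eval (s • v) (P a)) 0 0) → v = 0) :
    ∃ G : ι → MvPolynomial ι ℝ, AlgebraicIndependent ℝ G ∧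
      ∀ j, G j ∈ (aeval P : MvPolynomial σ ℝ →ₐ[ℝ] MvPolynomial ι ℝ).range := by
  classical
  have hstrict (Q : MvPolynomial ι ℝ) :
      HasStrictFDerivAt (fun t : ι → ℝ => eval t Q) (fderiv ℝ (fun t : ι → ℝ => eval t Q) 0) 0 :=
    (AnalyticOnNhd.eval_continuousLinearMap (ContinuousLinearMap.id ℝ (ι → ℝ)) Q 0
      trivial).hasStrictFDerivAt
  let D : (ι → ℝ) →ₗ[ℝ] (σ → ℝ) :=
    LinearMap.pi fun a => (fderiv ℝ (fun t : ι → ℝ => eval t (P a)) 0 : (ι → ℝ) →ₗ[ℝ] ℝ)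
  have hD : LinearMap.ker D = ⊥ := by
    rw [LinearMap.ker_eq_bot']
    intro v hv
    refine h v fun a => ?_
    have h1 : HasDerivAt (fun s : ℝ => s • v) v 0 := by
      simpa using (hasDerivAt_id (0 : ℝ)).smul_const v
    have h2 := (hstrict (P a)).hasFDerivAt
    have h3 : HasDerivAt (fun s : ℝ => eval (s • v) (P a))
        (fderiv ℝ (fun t : ι → ℝ => eval t (P a)) 0 v) 0 := by
      refine HasFDerivAt.comp_hasDerivAt (f := fun s : ℝ => s • v)
        (l := fun t : ι → ℝ => eval t (P a)) (0 : ℝ) ?_ h1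
      simpa using h2
    have h4 : fderiv ℝ (fun t : ι → ℝ => eval t (P a)) 0 v = 0 := congrFun hv a
    rwa [h4] at h3
  obtain ⟨π, hπ⟩ := D.exists_leftInverse_of_injective hD
  -- The combinations given by a left inverse `π` of the derivative have derivative `id` at `0`.
  let c : ι → σ → ℝ := fun j a => π (Pi.single a 1) j
  have hc (y : σ → ℝ) (j : ι) : π y j = ∑ a, c j a * y a := by
    have hs (a : σ) : (fun b => if a = b then (1 : ℝ) else 0) = Pi.single a 1 := by
      ext b
      simp [Pi.single_apply, eq_comm]
    rw [LinearMap.pi_apply_eq_sum_univ π y]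
    simp [c, Finset.sum_apply, mul_comm, hs]
  let G : ι → MvPolynomial ι ℝ := fun j => ∑ a, C (c j a) * P a
  have hGeval (t : ι → ℝ) (j : ι) : eval t (G j) = ∑ a, c j a * eval t (P a) := by
    simp [G, map_sum]
  have hGd : HasStrictFDerivAt (fun (t : ι → ℝ) j => eval t (G j))
      ((ContinuousLinearEquiv.refl ℝ (ι → ℝ) : (ι → ℝ) ≃L[ℝ] (ι → ℝ)) :
        (ι → ℝ) →L[ℝ] (ι → ℝ)) 0 := by
    rw [hasStrictFDerivAt_pi']
    intro j
    simp only [hGeval]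
    have := HasStrictFDerivAt.fun_sum (u := Finset.univ)
      fun a _ => (hstrict (P a)).const_mul (c j a)
    refine this.congr_fderiv ?_
    ext1 v
    have h1 := congrFun (LinearMap.congr_fun hπ v) j
    rw [LinearMap.comp_apply, hc] at h1
    simpa [sum_apply, D] using h1
  refine ⟨G, ?_, fun j => ⟨∑ a, C (c j a) * X a, by simp [G, map_sum, algebraMap_eq]⟩⟩
  rw [algebraicIndependent_iff]
  intro F hF
  have hvan : ∀ᶠ y in nhds (fun j => eval (0 : ι → ℝ) (G j)), eval y F = 0 := by
    rw [← hGd.map_nhds_eq_of_equiv, Filter.eventually_map]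
    refine Filter.Eventually.of_forall fun t => ?_
    have h1 := congrArg (eval t) hF
    rw [map_zero, eval_aeval_eq] at h1
    exact h1
  obtain ⟨ε, hε, hball⟩ := Metric.eventually_nhds_iff_ball.mp hvan
  refine MvPolynomial.funext_set
    (fun j => Metric.ball (eval (0 : ι → ℝ) (G j)) ε) (fun j => ?_) fun y hy => ?_
  · rw [Real.ball_eq_Ioo]
    exact Set.Ioo_infinite (by linarith)
  · rw [map_zero]
    refine hball y ?_
    rw [ball_pi _ hε]
    exact hy

/-! ### The moment map in affine coordinates -/

/-- A real function of `t` that is given by a polynomial in the coordinates of `t`. -/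
def IsPolynomialFun {ι : Type} (f : (ι → ℝ) → ℝ) : Prop :=
  ∃ P : MvPolynomial ι ℝ, ∀ t, eval t P = f t

namespace IsPolynomialFun

variable {ι : Type} {f g : (ι → ℝ) → ℝ}

theorem const (c : ℝ) : IsPolynomialFun fun _ : ι → ℝ => c := ⟨C c, fun t => by simp⟩

theorem coord (i : ι) : IsPolynomialFun fun t : ι → ℝ => t i := ⟨X i, fun t => by simp⟩

theorem add (hf : IsPolynomialFun f) (hg : IsPolynomialFun g) :
    IsPolynomialFun fun t => f t + g t := by
  obtain ⟨P, hP⟩ := hf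
  obtain ⟨Q, hQ⟩ := hg
  exact ⟨P + Q, fun t => by simp [hP, hQ]⟩

theorem mul (hf : IsPolynomialFun f) (hg : IsPolynomialFun g) :
    IsPolynomialFun fun t => f t * g t := by
  obtain ⟨P, hP⟩ := hf
  obtain ⟨Q, hQ⟩ := hg
  exact ⟨P * Q, fun t => by simp [hP, hQ]⟩

theorem sum {κ : Type*} (s : Finset κ) {F : κ → (ι → ℝ) → ℝ}
    (h : ∀ j ∈ s, IsPolynomialFun (F j)) : IsPolynomialFun fun t => ∑ j ∈ s, F j t := by
  classical
  induction s using Finset.induction_on with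
  | empty => simpa using const 0
  | insert j s hj ih =>
    simp only [Finset.sum_insert hj]
    exact (h j (by simp)).add (ih fun l hl => h l (by simp [hl]))

end IsPolynomialFun

/-- A family of polynomials whose coefficients are polynomial functions of the parameter `t`. -/
def IsPolynomialFamily {ι τ : Type} (F : (ι → ℝ) → MvPolynomial τ ℝ) : Prop :=
  ∀ b, IsPolynomialFun fun t => coeff b (F t)

namespace IsPolynomialFamily

variable {ι τ : Type} {F G : (ι → ℝ) → MvPolynomial τ ℝ}

theorem const (p : MvPolynomial τ ℝ) : IsPolynomialFamily fun _ : ι → ℝ => p :=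
  fun _ => IsPolynomialFun.const _

theorem C_of {f : (ι → ℝ) → ℝ} (hf : IsPolynomialFun f) :
    IsPolynomialFamily fun t => (C (f t) : MvPolynomial τ ℝ) := by
  classical
  intro b
  simp only [coeff_C]
  split_ifs
  · exact hf
  · exact IsPolynomialFun.const 0

theorem add (hF : IsPolynomialFamily F) (hG : IsPolynomialFamily G) :
    IsPolynomialFamily fun t => F t + G t := fun b => by
  simp only [coeff_add]
  exact (hF b).add (hG b)

theorem mul (hF : IsPolynomialFamily F) (hG : IsPolynomialFamily G) :
    IsPolynomialFamily fun t => F t * G t := fun b => by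
  classical
  simp only [coeff_mul]
  exact IsPolynomialFun.sum _ fun c _ => (hF c.1).mul (hG c.2)

theorem pow (hF : IsPolynomialFamily F) (j : ℕ) : IsPolynomialFamily fun t => F t ^ j := by
  induction j with
  | zero => simpa using const 1
  | succ j ih =>
    simp only [pow_succ]
    exact ih.mul hF

theorem sum {κ : Type*} (s : Finset κ) {F : κ → (ι → ℝ) → MvPolynomial τ ℝ}
    (h : ∀ j ∈ s, IsPolynomialFamily (F j)) : IsPolynomialFamily fun t => ∑ j ∈ s, F j t :=
  fun b => by
    simp only [coeff_sum]
    exact IsPolynomialFun.sum _ fun j hj => h j hj b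

end IsPolynomialFamily

/-- The moments are polynomials in the parameters. -/
theorem isPolynomialFun_momentMap {ι : Type} {n k d : ℕ} (ψ : (ι → ℝ) → MixtureData n k)
    (hμ : ∀ i j, IsPolynomialFun fun t => (ψ t).1 i j)
    (hl : ∀ i, IsPolynomialFun fun t => (ψ t).2.1 i)
    (hS : ∀ i j, IsPolynomialFun fun t => (ψ t).2.2 i j) (a : MomentIndex n d) :
    IsPolynomialFun fun t => momentMap n k d (ψ t) a := by
  refine IsPolynomialFun.sum _ fun i _ => (hl i).mul ((IsPolynomialFun.const _).mul ?_)
  refine IsPolynomialFamily.sum _ (fun j _ => (IsPolynomialFamily.const _).mul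
    (IsPolynomialFamily.pow ?_ _)) _
  refine (IsPolynomialFamily.sum _ fun p _ => ?_).add ((IsPolynomialFamily.const _).mul
    (IsPolynomialFamily.sum _ fun p _ => IsPolynomialFamily.sum _ fun q _ => ?_))
  · exact (IsPolynomialFamily.C_of (hμ i p)).mul (IsPolynomialFamily.const _)
  · exact ((IsPolynomialFamily.C_of (hS p q)).mul (IsPolynomialFamily.const _)).mul
      (IsPolynomialFamily.const _)

/-- If at some point `θ` of the parameter space no nonzero tangent vector kills the derivatives of
all moments, then the moment map is generically finite. -/
theorem identifiable_of_deriv_injective {n k d : ℕ} (θ : MixtureData n k)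
    (hθ : θ ∈ homoscedasticParams n k)
    (h : ∀ v : MixtureData n k, v ∈ (homoscedasticParams n k).direction →
      (∀ a : MomentIndex n d, HasDerivAt (fun s : ℝ => momentMap n k d (θ + s • v) a) 0 0) →
      v = 0) :
    AlgebraicallyIdentifiable n k d ∧ GeneralFiberFinite n k d := by
  classical
  have : Fintype (MomentIndex n d) := (Finsupp.finite_of_degree_le d).fintype
  obtain ⟨N, hN⟩ : ∃ N, Module.finrank ℝ (homoscedasticParams n k).direction = N := ⟨_, rfl⟩
  let b := Module.finBasisOfFinrankEq ℝ (homoscedasticParams n k).direction hN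
  let w : (Fin N → ℝ) ≃ₗ[ℝ] (homoscedasticParams n k).direction := b.equivFun.symm
  let ψ : (Fin N → ℝ) → MixtureData n k := fun t => θ + (w t : MixtureData n k)
  have hw (t : Fin N → ℝ) : (w t : MixtureData n k) = ∑ l, t l • (b l : MixtureData n k) := by
    simp [w, Module.Basis.equivFun_symm_apply]
  have hψ (t : Fin N → ℝ) : ψ t ∈ homoscedasticParams n k := by
    have := AffineSubspace.vadd_mem_of_mem_direction (w t).2 hθ
    rwa [vadd_eq_add, add_comm] at this
  have hsurj (θ' : MixtureData n k) (hθ' : θ' ∈ homoscedasticParams n k) : ∃ t, ψ t = θ' := by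
    refine ⟨w.symm ⟨θ' - θ, AffineSubspace.vsub_mem_direction hθ' hθ⟩, ?_⟩
    simp only [ψ, LinearEquiv.apply_symm_apply, add_sub_cancel]
  have hpoly (a : MomentIndex n d) : IsPolynomialFun fun t => momentMap n k d (ψ t) a := by
    refine isPolynomialFun_momentMap ψ (fun i j => ?_) (fun i => ?_) (fun i j => ?_) a
    all_goals
      simp only [ψ, hw, Prod.fst_add, Prod.snd_add, Prod.fst_sum, Prod.snd_sum, Pi.add_apply,
        Matrix.add_apply, Finset.sum_apply, Matrix.sum_apply, Prod.smul_fst, Prod.smul_snd,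
        Pi.smul_apply, Matrix.smul_apply, smul_eq_mul]
      exact (IsPolynomialFun.const _).add (IsPolynomialFun.sum _ fun l _ =>
        (IsPolynomialFun.coord l).mul (IsPolynomialFun.const _))
  choose P hP using hpoly
  have himage : homoscedasticSecant n k d = Set.range fun (t : Fin N → ℝ) a => eval t (P a) := by
    ext p
    constructor
    · rintro ⟨θ', hθ', rfl⟩
      obtain ⟨t, rfl⟩ := hsurj θ' hθ'
      exact ⟨t, funext fun a => hP a t⟩
    · rintro ⟨t, rfl⟩
      exact ⟨ψ t, hψ t, funext fun a => (hP a t).symm⟩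
  obtain ⟨G, hG, hGP⟩ := exists_algebraicIndependent_of_deriv P (fun v hv => by
    have h0 := h (w v) (w v).2 fun a => by
      have h1 := hv a
      simp only [hP] at h1
      simpa only [ψ, map_smul, Submodule.coe_smul] using h1
    exact w.map_eq_zero_iff.mp (Subtype.ext h0))
  constructor
  · rw [AlgebraicallyIdentifiable, himage, zariskiDim_range_eq P G hG hGP, Fintype.card_fin,
      homoscedasticParamsDim, hN]
  · obtain ⟨g, ⟨t, ht⟩, hg⟩ := exists_finite_fibers P G hG hGP
    refine ⟨g, ⟨_, himage ▸ ⟨t, rfl⟩, ht⟩, fun p _ hp => ((hg p hp).image ψ).subset ?_⟩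
    rintro θ' ⟨hθ', rfl⟩
    obtain ⟨t, rfl⟩ := hsurj θ' hθ'
    exact ⟨t, funext fun a => hP a t, rfl⟩

/-! ### Derivatives of the moment map -/

/-- The coefficient of `s ^ D` in the Taylor expansion of `exp (s p + s² q)`. -/
noncomputable def expTaylorCoeff (D : ℕ) (p q : ℝ) : ℝ :=
  ∑ j ∈ Finset.range (D + 1), 1 / (j ! : ℝ) *
    ∑ m ∈ Finset.range (j + 1), if m + 2 * (j - m) = D then p ^ m * q ^ (j - m) * j.choose m else 0

theorem sum_coeff_mul_prod_pow_eq_eval_homogeneousComponent {n : ℕ} (T : MvPolynomial (Fin n) ℝ)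
    (D : ℕ) (x : Fin n → ℝ) :
    ∑ a ∈ (Finsupp.finite_of_degree_eq (σ := Fin n) D).toFinset, coeff a T * ∏ i, x i ^ a i =
      eval x (homogeneousComponent D T) := by
  rw [eval_eq']
  symm
  have hsub : (homogeneousComponent D T).support ⊆
      (Finsupp.finite_of_degree_eq (σ := Fin n) D).toFinset := fun a ha => by
    rw [mem_support_iff, coeff_homogeneousComponent] at ha
    simp only [Set.Finite.mem_toFinset, Set.mem_ofPred_eq]
    by_contra hne
    simp [hne] at ha
  rw [Finset.sum_subset hsub fun a _ ha => by rw [notMem_support_iff.mp ha, zero_mul]]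
  refine Finset.sum_congr rfl fun a ha => ?_
  simp only [Set.Finite.mem_toFinset, Set.mem_ofPred_eq] at ha
  rw [coeff_homogeneousComponent, if_pos ha]

/-- The form with coefficients `m_a / a!`, `|a| = D`, made of the moments of order `D` of a
Gaussian, is a Taylor coefficient of the moment generating function along a line through `0`. -/
theorem sum_gaussianMoment_mul_prod_pow {n : ℕ} (m : Fin n → ℝ) (S : Matrix (Fin n) (Fin n) ℝ)
    (D : ℕ) (x : Fin n → ℝ) :
    ∑ a ∈ (Finsupp.finite_of_degree_eq (σ := Fin n) D).toFinset,
        gaussianMoment m S a * ((∏ i, ((a i)! : ℝ))⁻¹ * ∏ i, x i ^ a i) =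
      expTaylorCoeff D (∑ j, m j * x j) (1 / 2 * ∑ i, ∑ j, S i j * x i * x j) := by
  set L : MvPolynomial (Fin n) ℝ := ∑ i, C (m i) * X i with hL
  set Q : MvPolynomial (Fin n) ℝ :=
    C (1 / 2 : ℝ) * ∑ i, ∑ j, C (S i j) * X i * X j with hQ
  have hLh : L.IsHomogeneous 1 := IsHomogeneous.sum _ _ _ fun i _ => by
    simpa using (isHomogeneous_C (Fin n) (m i)).mul (isHomogeneous_X ℝ i)
  have hQh : Q.IsHomogeneous 2 := by
    rw [← zero_add 2]
    exact (isHomogeneous_C (Fin n) (1 / 2 : ℝ)).mul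
      (IsHomogeneous.sum Finset.univ _ 2 fun i _ => IsHomogeneous.sum Finset.univ _ 2 fun j _ =>
        ((isHomogeneous_C (Fin n) (S i j)).mul (isHomogeneous_X ℝ i)).mul (isHomogeneous_X ℝ j))
  have hcoeff : ∀ a ∈ (Finsupp.finite_of_degree_eq (σ := Fin n) D).toFinset,
      gaussianMoment m S a * ((∏ i, ((a i)! : ℝ))⁻¹ * ∏ i, x i ^ a i) =
      coeff a (∑ j ∈ Finset.range (D + 1), C (1 / (j ! : ℝ)) * (L + Q) ^ j) *
        ∏ i, x i ^ a i := fun a ha => by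
    simp only [Set.Finite.mem_toFinset, Set.mem_ofPred_eq] at ha
    have h0 : (∏ i, ((a i)! : ℝ)) ≠ 0 :=
      Finset.prod_ne_zero_iff.mpr fun i _ => by positivity
    rw [gaussianMoment, ha, gaussianCumulantPoly, ← hL, ← hQ]
    field_simp
  have hterm (j l : ℕ) : homogeneousComponent D (L ^ j * Q ^ l) =
      if j + 2 * l = D then L ^ j * Q ^ l else 0 := by
    have h1 : (L ^ j * Q ^ l).IsHomogeneous (j + 2 * l) := by
      simpa using (hLh.pow j).mul (hQh.pow l)
    rw [homogeneousComponent_of_mem ((mem_homogeneousSubmodule _ _).mpr h1)]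
    simp only [eq_comm]
  rw [Finset.sum_congr rfl hcoeff, sum_coeff_mul_prod_pow_eq_eval_homogeneousComponent, map_sum,
    map_sum, expTaylorCoeff]
  refine Finset.sum_congr rfl fun j _ => ?_
  rw [homogeneousComponent_C_mul, map_mul, eval_C, add_pow, map_sum, map_sum]
  congr 1
  refine Finset.sum_congr rfl fun l _ => ?_
  have hnat : L ^ l * Q ^ (j - l) * (j.choose l : MvPolynomial (Fin n) ℝ) =
      C (j.choose l : ℝ) * (L ^ l * Q ^ (j - l)) := by
    rw [mul_comm, map_natCast]
  rw [hnat, homogeneousComponent_C_mul, hterm]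
  split_ifs
  · simp [hL, hQ]
    ring
  · simp

section Tangent

variable {n k d : ℕ} (θ v : MixtureData n k)

/-- If all derivatives of the moments of order `D` at `θ` in the direction `v` vanish, so do those
of the Taylor coefficients of the moment generating function of the mixture. -/
theorem hasDerivAt_sum_expTaylorCoeff
    (hder : ∀ a : MomentIndex n d, HasDerivAt (fun s : ℝ => momentMap n k d (θ + s • v) a) 0 0)
    {D : ℕ} (hD : D ≤ d) (x : Fin n → ℝ) :
    HasDerivAt (fun s : ℝ => ∑ i, (θ + s • v).2.1 i * expTaylorCoeff D
      (∑ j, (θ + s • v).1 i j * x j) (1 / 2 * ∑ i, ∑ j, (θ + s • v).2.2 i j * x i * x j)) 0 0 := by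
  have key : HasDerivAt (fun s : ℝ =>
      ∑ a ∈ (Finsupp.finite_of_degree_eq (σ := Fin n) D).toFinset,
        (∑ i, (θ + s • v).2.1 i * gaussianMoment ((θ + s • v).1 i) (θ + s • v).2.2 a) *
          ((∏ i, ((a i)! : ℝ))⁻¹ * ∏ i, x i ^ a i)) 0 0 := by
    have h1 := HasDerivAt.fun_sum (u := (Finsupp.finite_of_degree_eq (σ := Fin n) D).toFinset)
      (A := fun a s => (∑ i, (θ + s • v).2.1 i *
        gaussianMoment ((θ + s • v).1 i) (θ + s • v).2.2 a) *
          ((∏ i, ((a i)! : ℝ))⁻¹ * ∏ i, x i ^ a i)) (A' := fun _ => 0) (x := (0 : ℝ))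
      fun a ha => by
        simp only [Set.Finite.mem_toFinset, Set.mem_ofPred_eq] at ha
        simpa only [zero_mul, momentMap] using (hder ⟨a, ha.trans_le hD⟩).mul_const
          ((∏ i, ((a i)! : ℝ))⁻¹ * ∏ i, x i ^ a i)
    simpa using h1
  convert key using 2 with s
  simp only [Finset.sum_mul]
  refine Eq.trans ?_ Finset.sum_comm
  refine Finset.sum_congr rfl fun i _ => ?_
  rw [← sum_gaussianMoment_mul_prod_pow, Finset.mul_sum]
  refine Finset.sum_congr rfl fun a _ => ?_
  ring

/-- At a point with covariance matrix `0`, the vanishing of the derivatives of all moments of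
order at most `d` in the direction `v` is a system of identities between forms in `x`. -/
theorem tangent_identities (hS : θ.2.2 = 0)
    (hder : ∀ a : MomentIndex n d, HasDerivAt (fun s : ℝ => momentMap n k d (θ + s • v) a) 0 0)
    (x : Fin n → ℝ) (p p' : Fin k → ℝ) (q : ℝ) (hp : ∀ i, p i = ∑ j, θ.1 i j * x j)
    (hp' : ∀ i, p' i = ∑ j, v.1 i j * x j)
    (hq : q = 1 / 2 * ∑ i, ∑ j, v.2.2 i j * x i * x j) :
    (∑ i, v.2.1 i = 0) ∧
    (1 ≤ d → ∑ i, (v.2.1 i * p i + θ.2.1 i * p' i) = 0) ∧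
    (2 ≤ d → ∑ i, (v.2.1 i * (p i ^ 2 / 2) + θ.2.1 i * (p i * p' i + q)) = 0) ∧
    (3 ≤ d → ∑ i, (v.2.1 i * (p i ^ 3 / 6) + θ.2.1 i * (p i ^ 2 / 2 * p' i + p i * q)) = 0) ∧
    (4 ≤ d →
      ∑ i, (v.2.1 i * (p i ^ 4 / 24) + θ.2.1 i * (p i ^ 3 / 6 * p' i + p i ^ 2 / 2 * q)) = 0) := by
  have main {D : ℕ} (hD : D ≤ d) : HasDerivAt (fun s : ℝ => ∑ i, (θ.2.1 i + s * v.2.1 i) *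
      expTaylorCoeff D (p i + s * p' i) (s * q)) 0 0 := by
    convert hasDerivAt_sum_expTaylorCoeff θ v hder hD x using 2 with s
    refine Finset.sum_congr rfl fun i _ => ?_
    congr 2
    · rw [hp, hp', Finset.mul_sum, ← Finset.sum_add_distrib]
      refine Finset.sum_congr rfl fun j _ => ?_
      simp only [Prod.fst_add, Prod.smul_fst, Pi.add_apply, Pi.smul_apply, smul_eq_mul]
      ring
    · rw [hq, mul_left_comm, Finset.mul_sum]
      congr 1
      refine Finset.sum_congr rfl fun i _ => ?_
      rw [Finset.mul_sum]
      refine Finset.sum_congr rfl fun j _ => ?_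
      simp only [Prod.snd_add, Prod.smul_snd, Matrix.add_apply, Matrix.smul_apply, smul_eq_mul, hS,
        Matrix.zero_apply]
      ring
  have hlin (c e : ℝ) : HasDerivAt (fun s : ℝ => c + s * e) e 0 := by
    simpa using ((hasDerivAt_id (0 : ℝ)).mul_const e).const_add c
  have hlin' (e : ℝ) : HasDerivAt (fun s : ℝ => s * e) e 0 := by
    simpa using (hasDerivAt_id (0 : ℝ)).mul_const e
  refine ⟨?_, fun hd => ?_, fun hd => ?_, fun hd => ?_, fun hd => ?_⟩
  · have h1 := main (Nat.zero_le d)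
    simp only [expTaylorCoeff, Finset.sum_range_succ] at h1
    norm_num at h1
    exact (HasDerivAt.fun_sum (u := Finset.univ) fun i _ => hlin (θ.2.1 i) (v.2.1 i)).unique h1
  · have h1 := main hd
    simp only [expTaylorCoeff, Finset.sum_range_succ] at h1
    norm_num at h1
    refine Eq.trans ?_ ((HasDerivAt.fun_sum (u := Finset.univ) fun i _ =>
      (hlin (θ.2.1 i) (v.2.1 i)).fun_mul (hlin (p i) (p' i))).unique h1)
    exact Finset.sum_congr rfl fun i _ => by ring
  · have h1 := main hd
    simp only [expTaylorCoeff, Finset.sum_range_succ] at h1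
    norm_num [Nat.factorial, Nat.choose] at h1
    refine Eq.trans ?_ ((HasDerivAt.fun_sum (u := Finset.univ) fun i _ =>
      (hlin (θ.2.1 i) (v.2.1 i)).fun_mul ((hlin' q).fun_add
        (((hlin (p i) (p' i)).fun_pow 2).const_mul (1 / 2)))).unique h1)
    exact Finset.sum_congr rfl fun i _ => by ring
  · have h1 := main hd
    simp only [expTaylorCoeff, Finset.sum_range_succ] at h1
    norm_num [Nat.factorial, Nat.choose] at h1
    refine Eq.trans ?_ ((HasDerivAt.fun_sum (u := Finset.univ) fun i _ =>
      (hlin (θ.2.1 i) (v.2.1 i)).fun_mul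
        (((((hlin (p i) (p' i)).fun_mul (hlin' q)).mul_const 2).const_mul (1 / 2)).fun_add
        (((hlin (p i) (p' i)).fun_pow 3).const_mul (1 / 6)))).unique h1)
    exact Finset.sum_congr rfl fun i _ => by ring
  · have h1 := main hd
    simp only [expTaylorCoeff, Finset.sum_range_succ] at h1
    norm_num [Nat.factorial, Nat.choose] at h1
    refine Eq.trans ?_ ((HasDerivAt.fun_sum (u := Finset.univ) fun i _ =>
      (hlin (θ.2.1 i) (v.2.1 i)).fun_mul
        (((((hlin' q).fun_pow 2).const_mul (1 / 2)).fun_add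
        (((((hlin (p i) (p' i)).fun_pow 2).fun_mul (hlin' q)).mul_const 3).const_mul
          (1 / 6))).fun_add
        (((hlin (p i) (p' i)).fun_pow 4).const_mul (1 / 24)))).unique h1)
    exact Finset.sum_congr rfl fun i _ => by ring

end Tangent

/-! ### The linear algebra of the tangent identities -/

section FormIdentities

variable {κ : Type*} [Fintype κ] [DecidableEq κ] {a : κ → ℝ} {B : κ → κ → ℝ}

/-- The tangent identity of order three, restricted to the span of the means. -/
def CubicIdentity (a : κ → ℝ) (B : κ → κ → ℝ) : Prop :=
  ∀ y : κ → ℝ, ∑ r, (a r * y r ^ 3 / 6 + (∑ t, B r t * y t) * y r ^ 2 / 2) =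
    2 * (∑ r, y r) * ∑ r, (a r * y r ^ 2 / 2 + (∑ t, B r t * y t) * y r)

/-- The tangent identity of order four, restricted to the span of the means. -/
def QuarticIdentity (a : κ → ℝ) (B : κ → κ → ℝ) : Prop :=
  ∀ y : κ → ℝ, ∑ r, (a r * y r ^ 4 / 24 + (∑ t, B r t * y t) * y r ^ 3 / 6) =
    (∑ r, y r ^ 2) * ∑ r, (a r * y r ^ 2 / 2 + (∑ t, B r t * y t) * y r)

theorem CubicIdentity.coeff_cube (h : CubicIdentity a B) (i : κ) :
    a i / 6 + B i i / 2 = 2 * (a i / 2 + B i i) := by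
  have h1 := h (Pi.single i 1)
  simp only [Pi.single_apply, mul_ite, mul_one, mul_zero, Finset.sum_ite_eq', Finset.mem_univ,
    if_true] at h1
  rw [Fintype.sum_eq_single i fun r hr => by simp [hr],
    Fintype.sum_eq_single i fun r hr => by simp [hr]] at h1
  simp only [if_true] at h1
  linarith

theorem QuarticIdentity.coeff_fourth (h : QuarticIdentity a B) (i : κ) :
    a i / 24 + B i i / 6 = a i / 2 + B i i := by
  have h1 := h (Pi.single i 1)
  simp only [Pi.single_apply, mul_ite, mul_one, mul_zero, Finset.sum_ite_eq', Finset.mem_univ,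
    if_true] at h1
  rw [Fintype.sum_eq_single i fun r hr => by simp [hr],
    Fintype.sum_eq_single i fun r hr => by simp [hr],
    Fintype.sum_eq_single i fun r hr => by simp [hr]] at h1
  simp only [if_true] at h1
  linarith

theorem CubicIdentity.eval_two (h : CubicIdentity a B) {i j : κ} (hij : i ≠ j) (α β : ℝ) :
    a i * α ^ 3 / 6 + (B i i * α + B i j * β) * α ^ 2 / 2 +
      (a j * β ^ 3 / 6 + (B j i * α + B j j * β) * β ^ 2 / 2) =
    2 * (α + β) * (a i * α ^ 2 / 2 + (B i i * α + B i j * β) * α +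
      (a j * β ^ 2 / 2 + (B j i * α + B j j * β) * β)) := by
  obtain ⟨y, hy⟩ : ∃ y : κ → ℝ, y = Pi.single i α + Pi.single j β := ⟨_, rfl⟩
  have hi : y i = α := by simp [hy, hij]
  have hj : y j = β := by simp [hy, hij.symm]
  have hs (f : κ → ℝ) (hf : ∀ r, y r = 0 → f r = 0) : ∑ r, f r = f i + f j :=
    Fintype.sum_eq_add i j hij fun r hr => hf r (by simp [hy, hr.1, hr.2])
  have h1 := h y
  have hB (r : κ) := hs (fun t => B r t * y t) (fun t ht => by simp [ht])
  simp only [hB] at h1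
  rw [hs _ (fun r hr => by simp [hr]), hs _ (fun r hr => hr), hs _ (fun r hr => by simp [hr])] at h1
  simpa only [hi, hj] using h1

theorem CubicIdentity.eval_three (h : CubicIdentity a B) {i j l : κ} (hij : i ≠ j) (hil : i ≠ l)
    (hjl : j ≠ l) :
    a i / 6 + (B i i + B i j + B i l) / 2 + (a j / 6 + (B j i + B j j + B j l) / 2) +
      (a l / 6 + (B l i + B l j + B l l) / 2) =
    6 * (a i / 2 + (B i i + B i j + B i l) + (a j / 2 + (B j i + B j j + B j l)) +
      (a l / 2 + (B l i + B l j + B l l))) := by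
  obtain ⟨y, hy⟩ : ∃ y : κ → ℝ, y = Pi.single i 1 + Pi.single j 1 + Pi.single l 1 := ⟨_, rfl⟩
  have hi : y i = 1 := by simp [hy, hij, hil]
  have hj : y j = 1 := by simp [hy, hij.symm, hjl]
  have hl : y l = 1 := by simp [hy, hil.symm, hjl.symm]
  have hs (f : κ → ℝ) (hf : ∀ r, y r = 0 → f r = 0) : ∑ r, f r = f i + f j + f l := by
    rw [← Finset.sum_subset (Finset.subset_univ {i, j, l}) fun r _ hr => hf r (by
      simp only [Finset.mem_insert, Finset.mem_singleton, not_or] at hr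
      simp [hy, hr.1, hr.2.1, hr.2.2]), Finset.sum_insert (by simp [hij, hil]),
      Finset.sum_pair hjl, add_assoc]
  have h1 := h y
  have hB (r : κ) := hs (fun t => B r t * y t) (fun t ht => by simp [ht])
  simp only [hB] at h1
  rw [hs _ (fun r hr => by simp [hr]), hs _ (fun r hr => hr), hs _ (fun r hr => by simp [hr])] at h1
  simp only [hi, hj, hl] at h1
  linarith

/-- The coefficient of `yᵢ² yⱼ`. -/
theorem CubicIdentity.coeff_sq_mul (h : CubicIdentity a B) {i j : κ} (hij : i ≠ j) :
    B i j / 2 = 2 * (a i / 2 + B i i) + 2 * (B i j + B j i) := by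
  have h1 := h.eval_two hij 1 1
  have h2 := h.eval_two hij 1 (-1)
  have h3 := h.coeff_cube j
  linarith

/-- The coefficient of `yᵢ yⱼ yₗ`. -/
theorem CubicIdentity.coeff_mul_mul (h : CubicIdentity a B) {i j l : κ} (hij : i ≠ j) (hil : i ≠ l)
    (hjl : j ≠ l) : (B i j + B j i) + (B i l + B l i) + (B j l + B l j) = 0 := by
  have h1 := h.eval_three hij hil hjl
  have := h.coeff_cube i
  have := h.coeff_cube j
  have := h.coeff_cube l
  have := h.coeff_sq_mul hij
  have := h.coeff_sq_mul hij.symm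
  have := h.coeff_sq_mul hil
  have := h.coeff_sq_mul hil.symm
  have := h.coeff_sq_mul hjl
  have := h.coeff_sq_mul hjl.symm
  linarith

/-- The coefficients of a solution of the cubic identity are determined by the numbers
`aᵢ / 2 + Bᵢᵢ`. -/
theorem CubicIdentity.eq_zero_of_forall (h : CubicIdentity a B)
    (he : ∀ i, a i / 2 + B i i = 0) : (∀ i, a i = 0) ∧ ∀ i j, B i j = 0 := by
  have ha (i : κ) : a i = 0 := by linarith [h.coeff_cube i, he i]
  refine ⟨ha, fun i j => ?_⟩
  obtain rfl | hij := eq_or_ne i j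
  · linarith [he i, ha i]
  · linarith [h.coeff_sq_mul hij, h.coeff_sq_mul hij.symm, he i, he j]

/-- With at least four means besides the origin, the cubic identity has only the zero solution:
the coefficients of `yᵢ² yⱼ` and `yᵢ yⱼ yₗ` make the numbers `eᵢ = aᵢ / 2 + Bᵢᵢ` satisfy
`eᵢ + eⱼ + eₗ = 0` for all triples of distinct indices. -/
theorem CubicIdentity.eq_zero (h : CubicIdentity a B) (hκ : 4 ≤ Fintype.card κ) :
    (∀ i, a i = 0) ∧ ∀ i j, B i j = 0 := by
  have htriple {i j l : κ} (hij : i ≠ j) (hil : i ≠ l) (hjl : j ≠ l) :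
      (a i / 2 + B i i) + (a j / 2 + B j j) + (a l / 2 + B l l) = 0 := by
    linarith [h.coeff_mul_mul hij hil hjl, h.coeff_sq_mul hij, h.coeff_sq_mul hij.symm,
      h.coeff_sq_mul hil, h.coeff_sq_mul hil.symm, h.coeff_sq_mul hjl, h.coeff_sq_mul hjl.symm]
  refine h.eq_zero_of_forall fun i => ?_
  obtain ⟨j, hj, l, hl, t, ht, hjl, hjt, hlt⟩ := Finset.two_lt_card.mp
    (show 2 < ({i}ᶜ : Finset κ).card by rw [Finset.card_compl, Finset.card_singleton]; omega)
  simp only [Finset.mem_compl, Finset.mem_singleton] at hj hl ht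
  linarith [htriple (Ne.symm hj) (Ne.symm hl) hjl, htriple (Ne.symm hj) (Ne.symm ht) hjt,
    htriple (Ne.symm hl) (Ne.symm ht) hlt, htriple hjl hjt hlt]

/-- The coefficients of `yᵢ³` and `yᵢ⁴` are independent linear conditions on `aᵢ` and `Bᵢᵢ`. -/
theorem CubicIdentity.eq_zero_of_quartic (h : CubicIdentity a B) (h' : QuarticIdentity a B) :
    (∀ i, a i = 0) ∧ ∀ i j, B i j = 0 :=
  h.eq_zero_of_forall fun i => by linarith [h.coeff_cube i, h'.coeff_fourth i]

end FormIdentities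

/-! ### The differential at a simplex of means -/

/-- A quadratic form that vanishes identically has the zero symmetric matrix. -/
theorem eq_zero_of_isSymm_of_forall_sum_eq_zero {n : ℕ} {S : Matrix (Fin n) (Fin n) ℝ}
    (hS : S.IsSymm) (h : ∀ x : Fin n → ℝ, ∑ i, ∑ j, S i j * x i * x j = 0) : S = 0 := by
  have hdiag (i : Fin n) : S i i = 0 := by
    simpa [Pi.single_apply] using h (Pi.single i 1)
  ext i j
  have h1 := h (Pi.single i 1 + Pi.single j 1)
  simp [Pi.single_apply, mul_add, Finset.sum_add_distrib, hdiag] at h1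
  rw [Matrix.zero_apply]
  linarith [hS.apply i j]

/-- The mixture with covariance matrix `0`, with one mean at the origin and the others at distinct
unit vectors. The weights `2` keep the weight `1 - 2 m` of the mean at the origin different from
zero. -/
noncomputable def simplexMixture {n m : ℕ} (e : Fin m → Fin n) : MixtureData n (m + 1) :=
  (Fin.cons 0 fun r => Pi.single (e r) 1, Fin.cons (1 - 2 * (m : ℝ)) fun _ => 2, 0)

theorem simplexMixture_mem {n m : ℕ} (e : Fin m → Fin n) :
    simplexMixture e ∈ homoscedasticParams n (m + 1) := by
  refine ⟨?_, Matrix.isSymm_zero⟩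
  simp [simplexMixture, Fin.sum_univ_succ]
  ring

/-- The tangent identities at the simplex mixture, without the covariance direction, which the
identity of order two determines. -/
theorem simplexMixture_tangent_identities {n m d : ℕ} (e : Fin m → Fin n)
    (v : MixtureData n (m + 1))
    (hder : ∀ a : MomentIndex n d,
      HasDerivAt (fun s : ℝ => momentMap n (m + 1) d (simplexMixture e + s • v) a) 0 0)
    (hd : 3 ≤ d) (x : Fin n → ℝ) :
    (v.2.1 0 + ∑ r : Fin m, v.2.1 r.succ = 0) ∧
    ((1 - 2 * (m : ℝ)) * ∑ j, v.1 0 j * x j +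
      ∑ r : Fin m, (v.2.1 r.succ * x (e r) + 2 * ∑ j, v.1 r.succ j * x j) = 0) ∧
    (1 / 2 * ∑ i, ∑ j, v.2.2 i j * x i * x j =
      - ∑ r : Fin m,
        (v.2.1 r.succ * x (e r) ^ 2 / 2 + (2 * ∑ j, v.1 r.succ j * x j) * x (e r))) ∧
    (∑ r : Fin m,
        (v.2.1 r.succ * x (e r) ^ 3 / 6 + (2 * ∑ j, v.1 r.succ j * x j) * x (e r) ^ 2 / 2) =
      2 * (∑ r : Fin m, x (e r)) * ∑ r : Fin m,
        (v.2.1 r.succ * x (e r) ^ 2 / 2 + (2 * ∑ j, v.1 r.succ j * x j) * x (e r))) ∧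
    (4 ≤ d → ∑ r : Fin m,
        (v.2.1 r.succ * x (e r) ^ 4 / 24 + (2 * ∑ j, v.1 r.succ j * x j) * x (e r) ^ 3 / 6) =
      (∑ r : Fin m, x (e r) ^ 2) * ∑ r : Fin m,
        (v.2.1 r.succ * x (e r) ^ 2 / 2 + (2 * ∑ j, v.1 r.succ j * x j) * x (e r))) := by
  have hp : ∀ i, (Fin.cons 0 fun r => x (e r) : Fin (m + 1) → ℝ) i =
      ∑ j, (simplexMixture e).1 i j * x j := by
    refine Fin.cases ?_ fun r => ?_
    · simp [simplexMixture]
    · simp [simplexMixture, Pi.single_apply]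
  obtain ⟨q, hq⟩ : ∃ q, q = 1 / 2 * ∑ i, ∑ j, v.2.2 i j * x i * x j := ⟨_, rfl⟩
  obtain ⟨p', hp'⟩ : ∃ p' : Fin (m + 1) → ℝ, ∀ i, p' i = ∑ j, v.1 i j * x j := ⟨_, fun _ => rfl⟩
  obtain ⟨h0, h1, h2, h3, h4⟩ := tangent_identities (simplexMixture e) v rfl hder x
    (Fin.cons 0 fun r => x (e r)) p' q hp hp' hq
  replace h1 := h1 (by omega)
  replace h2 := h2 (by omega)
  replace h3 := h3 hd
  simp only [← hp', ← hq]
  simp only [Fin.sum_univ_succ, Fin.cons_zero, Fin.cons_succ, simplexMixture] at h0 h1 h2 h3 h4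
  have hq' : q = - ∑ r : Fin m, (v.2.1 r.succ * x (e r) ^ 2 / 2 + (2 * p' r.succ) * x (e r)) := by
    have : ∑ r : Fin m, (v.2.1 r.succ * (x (e r) ^ 2 / 2) + 2 * (x (e r) * p' r.succ + q)) =
        ∑ r : Fin m, (v.2.1 r.succ * x (e r) ^ 2 / 2 + (2 * p' r.succ) * x (e r)) +
          2 * m * q := by
      rw [Finset.sum_congr rfl fun r _ => (by ring :
        v.2.1 r.succ * (x (e r) ^ 2 / 2) + 2 * (x (e r) * p' r.succ + q) =
          (v.2.1 r.succ * x (e r) ^ 2 / 2 + (2 * p' r.succ) * x (e r)) + 2 * q),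
        Finset.sum_add_distrib, Finset.sum_const, Finset.card_univ, Fintype.card_fin]
      simp only [nsmul_eq_mul]
      ring
    rw [this] at h2
    linarith
  refine ⟨h0, by simpa using h1, hq', ?_, fun hd4 => ?_⟩
  · have : ∑ r : Fin m, (v.2.1 r.succ * (x (e r) ^ 3 / 6) +
        2 * (x (e r) ^ 2 / 2 * p' r.succ + x (e r) * q)) =
        ∑ r : Fin m, (v.2.1 r.succ * x (e r) ^ 3 / 6 + (2 * p' r.succ) * x (e r) ^ 2 / 2) +
          2 * (∑ r : Fin m, x (e r)) * q := by
      rw [Finset.mul_sum, Finset.sum_mul, ← Finset.sum_add_distrib]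
      exact Finset.sum_congr rfl fun r _ => by ring
    rw [this] at h3
    linear_combination h3 - 2 * (∑ r : Fin m, x (e r)) * hq'
  · replace h4 := h4 hd4
    have : ∑ r : Fin m, (v.2.1 r.succ * (x (e r) ^ 4 / 24) +
        2 * (x (e r) ^ 3 / 6 * p' r.succ + x (e r) ^ 2 / 2 * q)) =
        ∑ r : Fin m, (v.2.1 r.succ * x (e r) ^ 4 / 24 + (2 * p' r.succ) * x (e r) ^ 3 / 6) +
          (∑ r : Fin m, x (e r) ^ 2) * q := by
      rw [Finset.sum_mul, ← Finset.sum_add_distrib]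
      exact Finset.sum_congr rfl fun r _ => by ring
    rw [this] at h4
    linear_combination h4 - (∑ r : Fin m, x (e r) ^ 2) * hq'

/-- The moment map is an immersion at the simplex mixture. -/
theorem simplexMixture_deriv_injective {n m d : ℕ} {e : Fin m → Fin n}
    (he : Function.Injective e) (hd : 3 ≤ d) (hmd : 4 ≤ m ∨ 4 ≤ d) (v : MixtureData n (m + 1))
    (hS : v.2.2.IsSymm)
    (hder : ∀ a : MomentIndex n d,
      HasDerivAt (fun s : ℝ => momentMap n (m + 1) d (simplexMixture e + s • v) a) 0 0) :
    v = 0 := by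
  have hid := simplexMixture_tangent_identities e v hder hd
  -- For `x` in the span of the means, only the coordinates `e t` of the tangent means matter.
  have hsum (y : Fin m → ℝ) (r : Fin m) :
      2 * ∑ j, v.1 r.succ j * Function.extend e y 0 j =
        ∑ t, (2 * v.1 r.succ (e t)) * y t := by
    rw [Finset.mul_sum]
    symm
    refine Fintype.sum_of_injective e he _ _ (fun j hj => ?_) fun t => ?_
    · rw [Function.extend_apply' _ _ _ hj]
      simp
    · rw [he.extend_apply]
      ring
  have hcubic : CubicIdentity (fun r => v.2.1 r.succ) fun r t => 2 * v.1 r.succ (e t) := by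
    intro y
    have h := (hid (Function.extend e y 0)).2.2.2.1
    simpa only [hsum, he.extend_apply] using h
  obtain ⟨ha, hB⟩ : (∀ r : Fin m, v.2.1 r.succ = 0) ∧
      ∀ r t : Fin m, 2 * v.1 r.succ (e t) = 0 := by
    obtain hm | hd4 := hmd
    · exact hcubic.eq_zero (by simpa using hm)
    · refine hcubic.eq_zero_of_quartic fun y => ?_
      have h := (hid (Function.extend e y 0)).2.2.2.2 hd4
      simpa only [hsum, he.extend_apply] using h
  have hμ (r : Fin m) (j : Fin n) : v.1 r.succ j = 0 := by
    by_cases hj : j ∈ Set.range e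
    · obtain ⟨t, rfl⟩ := hj
      linarith [hB r t]
    · -- The coefficient of `xᵣ² xⱼ`, where `xⱼ` is a coordinate vanishing on all means.
      have hne (t : Fin m) : e t ≠ j := fun h => hj ⟨t, h⟩
      have hx (t : Fin m) : (Pi.single (e r) 1 + Pi.single j 1 : Fin n → ℝ) (e t) =
          if t = r then 1 else 0 := by
        simp [Pi.single_apply, hne, he.eq_iff]
      have hv (t : Fin m) :
          ∑ l, v.1 t.succ l * (Pi.single (e r) 1 + Pi.single j 1 : Fin n → ℝ) l =
            v.1 t.succ j := by
        have := hB t r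
        simp [Pi.single_apply, mul_add, Finset.sum_add_distrib]
        linarith
      have h := (hid (Pi.single (e r) 1 + Pi.single j 1)).2.2.2.1
      simp only [hx, hv, ha] at h
      simp [ite_div] at h
      linarith
  have hl0 : v.2.1 0 = 0 := by
    have h := (hid 0).1
    simpa [ha] using h
  have hμ0 (j : Fin n) : v.1 0 j = 0 := by
    have h := (hid (Pi.single j 1)).2.1
    simp only [ha, hμ] at h
    simp [Pi.single_apply] at h
    refine h.resolve_left fun h0 => ?_
    have h1 : 1 = 2 * m := by exact_mod_cast sub_eq_zero.mp h0
    omega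
  refine Prod.ext (funext fun i => funext fun j => ?_) (Prod.ext (funext fun i => ?_) ?_)
  · exact Fin.cases (hμ0 j) (fun r => hμ r j) i
  · exact Fin.cases hl0 ha i
  · refine eq_zero_of_isSymm_of_forall_sum_eq_zero hS fun x => ?_
    have h := (hid x).2.2.1
    simp only [ha, hμ] at h
    simpa using h

/-- Generic identifiability follows from the injectivity of the differential at the simplex
mixture. -/
theorem identifiable_of_four_le {n m d : ℕ} (hm : m ≤ n) (hd : 3 ≤ d) (hmd : 4 ≤ m ∨ 4 ≤ d) :
    AlgebraicallyIdentifiable n (m + 1) d ∧ GeneralFiberFinite n (m + 1) d := by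
  refine identifiable_of_deriv_injective (simplexMixture (Fin.castLE hm)) (simplexMixture_mem _)
    fun v hv hder => simplexMixture_deriv_injective (Fin.castLE_injective hm) hd hmd v ?_ hder
  have h := AffineSubspace.vadd_mem_of_mem_direction hv (simplexMixture_mem (Fin.castLE hm))
  have h2 : (v.2.2 + 0).IsSymm := h.2
  rwa [add_zero] at h2

theorem mainTheorem2 (n k : ℕ) (hk : k ≤ n + 1) :
    (5 ≤ k → AlgebraicallyIdentifiable n k 3 ∧ GeneralFiberFinite n k 3) ∧
      (k = 2 ∨ k = 3 ∨ k = 4 →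
        AlgebraicallyIdentifiable n k 4 ∧ GeneralFiberFinite n k 4) := by
  obtain _ | m := k
  · omega
  · exact ⟨fun h => identifiable_of_four_le (by omega) le_rfl (Or.inl (by omega)),
      fun _ => identifiable_of_four_le (by omega) (by omega) (Or.inr le_rfl)⟩
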